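/- **Setting.** Let $A=(A_{ij})_{i,j\in\mathbf Z}$ be a lower triangular complex matrix ($A_{ij}=0$ for $j>i$) and let $g=e^{A}$, an invertible lower triangular matrix with inverse $g^{-1}$. Put $e_i=z^{-i-1}$ and define the adapted bases, as formal Laurent series, by $$w^g_k(z)=g(z^{k-1})=\sum_{j\le k-1} g_{-j-1,-k}\,z^j,\qquad w^{g*}_k(z)=(\tilde g^{\,t})^{-1}(z^{k-1})=\sum_{j\le k-1}(g^{-1})_{k-1,j}\,z^j\qquad(k\in\mathbf Z),$$ where $\tilde g=\iota g\iota$, $\iota(e_i)=e_{-i-1}$. On the (completed) fermionic Fock space, with basis the semi-infinite wedges $e_{\ell_1}\wedge e_{\ell_2}\wedge\cdots$ and vacuum $|0\rangle=e_{-1}\wedge e_{-2}\wedge\cdots$, let $\psi_i=e_i\wedge$, let $\psi_i^*$ be interior multiplication by the dual vector of $e_i$, and let $:\!\psi_i\psi_j^*\!:\;=\psi_i\psi_j^*-\langle0|\psi_i\psi^*_j|0\rangle$, $$\psi(z)=\sum_{i\in\mathbf Z}\psi_i z^i,\qquad \psi^*(z)=\sum_{i\in\mathbf Z}\psi^*_i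 z^{-i-1},\qquad \hat g=\exp\Big(\sum_{i,j}A_{ij}:\!\psi_i\psi_j^*\!:\Big).$$ The pair correlator at $\mathbf t=0$ is $$\tilde K^g_2(z,w)=\begin{cases}\ \ \langle0|\psi(z)\psi^*(w)\hat g|0\rangle & \text{if } |z|>|w|,\\ -\langle0|\psi^*(w)\psi(z)\hat g|0\rangle&\text{if } |z|<|w|.\end{cases}$$ **Proposition.** $$\tilde K^g_2(z,w)=\begin{cases}\ \ \sum_{j\ge1}w^g_j(w)\,w^{g*}_{-j+1}(z)& \text{if } |z|>|w|,\\ -\sum_{j\ge1}w^g_{-j+1}(w)\,w^{g*}_{j}(z)& \text{if } |z|<|w|.\end{cases}$$ This holds in the following two senses. 1. For every such $g$, each of the two lines is an identity of formal double Laurent series in $z,w$: for all $a,b\in\mathbf Z$ only finitely many $j$ contribute to the coefficient of $z^aw^b$ on the right, and their sum is the coefficient of $z^aw^b$ in the corresponding vacuum expectation value. 2. Suppose that there are $R>0$ and $C$ with $|g_{km}|\,|(g^{-1})_{mi}|\le C R^{k-i}$ for all integers $i\le m\le k$ (for instance $R=1$ when $g$ and $g^{-1}$ are bounded on $L^2(S^1)$).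 Then the series $w^g_k(z)$, $w^{g*}_k(z)$ converge absolutely for $|z|>R$, and for all complex $z,w$ with $|z|,|w|>R$ and $|z|\neq|w|$ the double series defining $\tilde K_2^g(z,w)$ converges absolutely, the series over $j$ on the right converges absolutely, and the stated equality of complex numbers holds. -/

import Mathlib

noncomputable section

namespace PairCorr

open Set

/-! ### Lower triangular doubly infinite matrices -/

/-- The ring of lower triangular matrices `(A i j)`, `i j : ℤ`, over `ℂ` (`A i j = 0` for `j > i`),
with the matrix product: the incidence algebra of `ℤ` with the reversed order. -/
abbrev LowerTri : Type := IncidenceAlgebra ℂ ℤᵒᵈ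

/-- The `(i, j)` matrix entry. -/
def entry (A : LowerTri) (i j : ℤ) : ℂ := A (OrderDual.toDual i) (OrderDual.toDual j)

theorem entry_eq_zero (A : LowerTri) {i j : ℤ} (h : i < j) : entry A i j = 0 := by
  apply IncidenceAlgebra.apply_eq_zero_of_not_le
  simpa using h

theorem entry_mul (A B : LowerTri) (i j : ℤ) :
    entry (A * B) i j = ∑ k ∈ Finset.Icc j i, entry A i k * entry B k j := by
  simp only [entry, IncidenceAlgebra.mul_apply]
  refine Finset.sum_bij (fun x _ => OrderDual.ofDual x) ?_ ?_ ?_ ?_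
  · intro x hx
    rw [Finset.mem_Icc] at hx ⊢
    exact ⟨hx.2, hx.1⟩
  · intro x _ y _ h
    exact h
  · intro k hk
    rw [Finset.mem_Icc] at hk
    exact ⟨OrderDual.toDual k, Finset.mem_Icc.2 ⟨hk.2, hk.1⟩, rfl⟩
  · intro x _
    rfl

/-- `g = e ^ A` as matrices: every entry of `g` is the sum of the exponential series. -/
def IsMatrixExp (A g : LowerTri) : Prop :=
  ∀ i j : ℤ, HasSum (fun n : ℕ => ((n.factorial : ℂ))⁻¹ * entry (A ^ n) i j) (entry g i j)

/-! ### Adapted bases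

A formal (two-sided) Laurent series is given by its coefficients `ℤ → ℂ`.
The basis vectors are `e_i = z ^ (-i - 1)`. -/

/-- The series `M (z ^ k)`, where `M` acts by `M e_i = ∑ j, M j i • e_j` and `z ^ k = e_{-k-1}`:
its coefficient of `z ^ j` (that is, of `e_{-j-1}`) is `M (-j-1) (-k-1)`. -/
def applyMonomial (M : ℤ → ℤ → ℂ) (k : ℤ) : ℤ → ℂ := fun j => M (-j - 1) (-k - 1)

/-- The conjugation `ι ∘ M ∘ ι` by the involution `ι : e_i ↦ e_{-i-1}`. -/
def conjInvol (M : ℤ → ℤ → ℂ) : ℤ → ℤ → ℂ := fun i j => M (-i - 1) (-j - 1)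

/-- The adapted basis `w^g_k = g (z ^ (k - 1))`. -/
def adapted (g : LowerTriˣ) (k : ℤ) : ℤ → ℂ := applyMonomial (entry (g : LowerTri)) (k - 1)

/-- The dual adapted basis `w^{g*}_k = (ι g⁻¹ ι)ᵀ (z ^ (k - 1))`. -/
def adaptedDual (g : LowerTriˣ) (k : ℤ) : ℤ → ℂ :=
  applyMonomial (fun i j => conjInvol (entry ((g⁻¹ : LowerTriˣ) : LowerTri)) j i) (k - 1)

theorem adapted_apply (g : LowerTriˣ) (k j : ℤ) :
    adapted g k j = entry (g : LowerTri) (-j - 1) (-k) := by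
  simp [adapted, applyMonomial]

theorem adaptedDual_apply (g : LowerTriˣ) (k j : ℤ) :
    adaptedDual g k j = entry ((g⁻¹ : LowerTriˣ) : LowerTri) (k - 1) j := by
  simp [adaptedDual, applyMonomial, conjInvol]

/-- The value at `z` of a formal Laurent series. -/
def evalSeries (f : ℤ → ℂ) (z : ℂ) : ℂ := ∑' j : ℤ, f j * z ^ j

/-! ### Fermionic Fock space -/

/-- A set of occupied sites: it contains all sufficiently negative integers and no sufficiently
large ones. These are the sets `{λ_i - i + N : i ≥ 1}`, for a partition `λ` and a charge `N`, and
they label the basis `e_{ℓ_1} ∧ e_{ℓ_2} ∧ ⋯` (`ℓ_1 > ℓ_2 > ⋯`) of the Fock space. -/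
def Maya : Type :=
  {S : Set ℤ // ∃ a b : ℤ, (∀ k, k < a → k ∈ S) ∧ (∀ k, b ≤ k → k ∉ S)}

namespace Maya

/-- The Dirac sea, all negative sites occupied. -/
def vac : Maya := ⟨{k | k < 0}, 0, 0, fun _ h => h, fun _ h h' => absurd h' (not_lt.2 h)⟩

/-- Add the site `i`. -/
def add (S : Maya) (i : ℤ) : Maya :=
  ⟨insert i S.1, by
    obtain ⟨a, b, ha, hb⟩ := S.2
    refine ⟨a, max b (i + 1), fun k hk => Or.inr (ha k hk), fun k hk hk' => ?_⟩
    rcases hk' with rfl | hk'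
    · have := (le_max_right b (k + 1)).trans hk
      omega
    · exact hb k ((le_max_left _ _).trans hk) hk'⟩

/-- Remove the site `i`. -/
def del (S : Maya) (i : ℤ) : Maya :=
  ⟨S.1 \ {i}, by
    obtain ⟨a, b, ha, hb⟩ := S.2
    refine ⟨min a i, b, fun k hk => ⟨ha k (hk.trans_le (min_le_left _ _)), ?_⟩,
      fun k hk hk' => hb k hk hk'.1⟩
    have := hk.trans_le (min_le_right a i)
    simp only [mem_singleton_iff]
    omega⟩

/-- The sign `(-1) ^ #{k ∈ S : k > i}` produced by moving `e_i` to its place in the wedge. -/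
def sign (S : Maya) (i : ℤ) : ℂ := (-1) ^ {k | k ∈ S.1 ∧ i < k}.ncard

end Maya

/-- The fermionic Fock space, completed so as to contain arbitrary formal linear combinations of
the basis vectors (the completion contains `ĝ|0⟩`): `f S` is the coefficient of the basis
vector with label `S`. -/
abbrev Fock : Type := Maya → ℂ

/-- The right vacuum `|0⟩`. -/
def ketVac : Fock := by
  classical
  exact fun S => if S = Maya.vac then 1 else 0

/-- The left vacuum `⟨0|`. -/
def braVac (f : Fock) : ℂ := f Maya.vac

open Classical in
/-- The creation operator `ψ_i = e_i ∧`. -/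
def psi (i : ℤ) : Fock →ₗ[ℂ] Fock where
  toFun f S := if i ∈ S.1 then S.sign i * f (S.del i) else 0
  map_add' f h := by
    funext S
    by_cases hi : i ∈ S.1 <;> simp [hi, mul_add]
  map_smul' c f := by
    funext S
    by_cases hi : i ∈ S.1 <;> simp [hi, mul_left_comm]

open Classical in
/-- The annihilation operator `ψ*_i`, interior multiplication by the dual vector of `e_i`. -/
def psiStar (i : ℤ) : Fock →ₗ[ℂ] Fock where
  toFun f S := if i ∈ S.1 then 0 else S.sign i * f (S.add i)
  map_add' f h := by
    funext S
    by_cases hi : i ∈ S.1 <;> simp [hi, mul_add]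
  map_smul' c f := by
    funext S
    by_cases hi : i ∈ S.1 <;> simp [hi, mul_left_comm]

/-- The normal ordered product `:ψ_i ψ*_j: = ψ_i ψ*_j - ⟨0|ψ_i ψ*_j|0⟩`. -/
def normalOrd (i j : ℤ) : Fock →ₗ[ℂ] Fock :=
  psi i ∘ₗ psiStar j - (if i = j ∧ i < 0 then (1 : ℂ) else 0) • LinearMap.id

/-- Only finitely many terms of `∑ A_{ij} :ψ_i ψ*_j:` contribute to a given coefficient. -/
theorem support_gen_subset (A : LowerTri) (f : Fock) (S : Maya) {a b : ℤ}
    (ha : ∀ k, k < a → k ∈ S.1) (hb : ∀ k, b ≤ k → k ∉ S.1) :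
    (Function.support fun p : ℤ × ℤ => entry A p.1 p.2 * normalOrd p.1 p.2 f S) ⊆
      Set.Icc (min a 0) (max b 0) ×ˢ Set.Icc (min a 0) (max b 0) := by
  rintro ⟨i, j⟩ hp
  have hA : j ≤ i := by
    by_contra h
    exact hp (by simp [entry_eq_zero A (not_le.1 h)])
  have hN : normalOrd i j f S ≠ 0 := fun h => hp (by simp [h])
  simp only [Set.mem_prod, Set.mem_Icc]
  simp only [normalOrd, LinearMap.sub_apply, LinearMap.comp_apply, LinearMap.smul_apply,
    LinearMap.id_apply, psi, psiStar, LinearMap.coe_mk, AddHom.coe_mk, Pi.sub_apply,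
    Pi.smul_apply, smul_eq_mul] at hN
  by_contra hcon
  apply hN
  by_cases hij : i = j
  · subst hij
    have hout : i < min a 0 ∨ max b 0 < i := by
      by_contra h
      push Not at h
      exact hcon ⟨⟨h.1, h.2⟩, h.1, h.2⟩
    rcases hout with h | h
    · have h1 : i ∈ S.1 := ha i (h.trans_le (min_le_left _ _))
      have h2 : i < 0 := h.trans_le (min_le_right _ _)
      have h3 : i ∉ (S.del i).1 := by simp [Maya.del]
      have h4 : (S.del i).add i = S := by
        apply Subtype.ext
        simp [Maya.del, Maya.add, h1]
      have h5 : (S.del i).sign i = S.sign i := by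
        unfold Maya.sign
        congr 2
        ext k
        simp only [Maya.del, Set.mem_ofPred_eq, Set.mem_sdiff, Set.mem_singleton_iff]
        constructor
        · exact fun h => ⟨h.1.1, h.2⟩
        · exact fun h => ⟨⟨h.1, h.2.ne'⟩, h.2⟩
      have h6 : S.sign i * S.sign i = 1 := by
        unfold Maya.sign
        rw [← mul_pow]
        simp
      rw [if_pos h1, if_neg h3, h4, h5, if_pos ⟨rfl, h2⟩, ← mul_assoc, h6]
      ring
    · have h1 : i ∉ S.1 := hb i ((le_max_left _ _).trans h.le)
      have h2 : ¬ i < 0 := not_lt.2 ((le_max_right _ _).trans h.le)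
      simp [h1, h2]
  · have hij2 : ¬ (i = j ∧ i < 0) := fun h => hij h.1
    rw [if_neg hij2]
    by_cases hi : i ∈ S.1
    · have hib : i < b := by
        by_contra h
        exact hb i (not_lt.1 h) hi
      by_cases hj : j ∈ (S.del i).1
      · simp [hj]
      · have hja : a ≤ j := by
          by_contra h
          exact hj (by simp only [Maya.del, Set.mem_sdiff, Set.mem_singleton_iff]; exact ⟨ha j (not_le.1 h), fun h' => hij h'.symm⟩)
        exfalso
        apply hcon
        simp only [min_le_iff, le_max_iff]
        omega
    · simp [hi]

theorem finite_support_gen (A : LowerTri) (f : Fock) (S : Maya) :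
    (Function.support fun p : ℤ × ℤ => entry A p.1 p.2 * normalOrd p.1 p.2 f S).Finite := by
  obtain ⟨a, b, ha, hb⟩ := S.2
  exact ((Set.finite_Icc _ _).prod (Set.finite_Icc _ _)).subset (support_gen_subset A f S ha hb)

/-- The operator `∑_{i,j} A_{ij} :ψ_i ψ*_j:`. -/
def gen (A : LowerTri) : Fock →ₗ[ℂ] Fock where
  toFun f S := ∑ᶠ p : ℤ × ℤ, entry A p.1 p.2 * normalOrd p.1 p.2 f S
  map_add' f h := by
    funext S
    simp only [map_add, Pi.add_apply, mul_add]
    exact finsum_add_distrib (finite_support_gen A f S) (finite_support_gen A h S)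
  map_smul' c f := by
    funext S
    simp only [map_smul, Pi.smul_apply, smul_eq_mul, RingHom.id_apply]
    rw [mul_finsum' _ _ (finite_support_gen A f S)]
    exact finsum_congr fun p => by ring

/-- The fermionic representation `ĝ = exp (∑ A_{ij} :ψ_i ψ*_j:)` of `g = e ^ A`; the exponential
series is summed coefficient by coefficient. -/
def groupOp (A : LowerTri) (f : Fock) : Fock :=
  fun S => ∑' n : ℕ, ((n.factorial : ℂ))⁻¹ * ((gen A ^ n) f) S

/-- The labels that agree with the Dirac sea outside `[a, b)`. -/
def Maya.window (a b : ℤ) : Set Maya :=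
  {T | (∀ k, k < a → k ∈ T.1) ∧ ∀ k, b ≤ k → k ∉ T.1}

theorem Maya.finite_window (a b : ℤ) : (Maya.window a b).Finite := by
  refine Set.Finite.of_finite_image (f := fun T : Maya => T.1 ∩ Set.Ico a b)
    ((Set.finite_Ico a b).finite_subsets.subset ?_) ?_
  · rintro _ ⟨T, _, rfl⟩
    exact Set.inter_subset_right
  · intro T hT U hU h
    apply Subtype.ext
    ext k
    by_cases h1 : k < a
    · exact iff_of_true (hT.1 k h1) (hU.1 k h1)
    · by_cases h2 : b ≤ k
      · exact iff_of_false (hT.2 k h2) (hU.2 k h2)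
      · have h3 : k ∈ Set.Ico a b := ⟨not_lt.1 h1, not_le.1 h2⟩
        have h4 := Set.ext_iff.1 h k
        simpa [h3.1, h3.2] using h4

theorem norm_normalOrd_le {a b i j : ℤ} (hi : a ≤ i) (hj : j ≤ i) {f : Fock} {M : ℝ}
    (hM : ∀ T ∈ Maya.window a b, ‖f T‖ ≤ M) {T : Maya} (hT : T ∈ Maya.window a b) :
    ‖normalOrd i j f T‖ ≤ 2 * M := by
  have hM0 : 0 ≤ M := (norm_nonneg _).trans (hM T hT)
  have hs : ∀ (U : Maya) (k : ℤ), ‖U.sign k‖ = 1 := fun U k => by simp [Maya.sign]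
  have h1 : ‖psi i (psiStar j f) T‖ ≤ M := by
    simp only [psi, psiStar, LinearMap.coe_mk, AddHom.coe_mk]
    split_ifs with h1 h2
    · simpa using hM0
    · rw [norm_mul, norm_mul, hs, hs, one_mul, one_mul]
      apply hM
      have hib : i < b := by
        by_contra h
        exact hT.2 i (not_lt.1 h) h1
      refine ⟨fun k hk => ?_, fun k hk hk' => ?_⟩
      · exact Or.inr ((Set.mem_sdiff _).2 ⟨hT.1 k hk, fun h => by
          rw [Set.mem_singleton_iff] at h
          omega⟩)
      · rcases hk' with h | h
        · omega
        · exact hT.2 k hk ((Set.mem_sdiff _).1 h).1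
    · simpa using hM0
  have h2 : ‖(if i = j ∧ i < 0 then (1 : ℂ) else 0) * f T‖ ≤ M := by
    split_ifs
    · simpa using hM T hT
    · simpa using hM0
  calc ‖normalOrd i j f T‖
      = ‖psi i (psiStar j f) T - (if i = j ∧ i < 0 then (1 : ℂ) else 0) * f T‖ := rfl
    _ ≤ _ := norm_sub_le _ _
    _ ≤ 2 * M := by linarith

/-- The series defining `groupOp` converges absolutely in every coefficient. -/
theorem summable_groupOp (A : LowerTri) (f : Fock) (S : Maya) :
    Summable fun n : ℕ => ((n.factorial : ℂ))⁻¹ * ((gen A ^ n) f) S := by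
  obtain ⟨a₀, b₀, ha₀, hb₀⟩ := S.2
  set a := min a₀ 0 with ha
  set b := max b₀ 0 with hb
  have hS : S ∈ Maya.window a b :=
    ⟨fun k hk => ha₀ k (hk.trans_le (min_le_left _ _)),
      fun k hk => hb₀ k ((le_max_left _ _).trans hk)⟩
  obtain ⟨M, hM⟩ : ∃ M : ℝ, ∀ T ∈ Maya.window a b, ‖f T‖ ≤ M := by
    obtain ⟨M, hM⟩ := ((Maya.finite_window a b).image fun T => ‖f T‖).bddAbove
    exact ⟨M, fun T hT => hM ⟨T, hT, rfl⟩⟩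
  set P : Finset (ℤ × ℤ) := Finset.Icc a b ×ˢ Finset.Icc a b with hP
  set B : ℝ := ∑ p ∈ P, ‖entry A p.1 p.2‖ * 2 with hB
  have key : ∀ (h : Fock) (N : ℝ), (∀ T ∈ Maya.window a b, ‖h T‖ ≤ N) →
      ∀ T ∈ Maya.window a b, ‖gen A h T‖ ≤ B * N := by
    intro h N hN T hT
    have hsub : (Function.support fun p : ℤ × ℤ =>
        entry A p.1 p.2 * normalOrd p.1 p.2 h T) ⊆ (P : Set (ℤ × ℤ)) := by
      refine (support_gen_subset A h T hT.1 hT.2).trans ?_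
      rw [hP, Finset.coe_product, Finset.coe_Icc,
        min_eq_left (min_le_right _ _), max_eq_left (le_max_right _ _)]
    have hgen : gen A h T = ∑ p ∈ P, entry A p.1 p.2 * normalOrd p.1 p.2 h T :=
      finsum_eq_sum_of_support_subset _ hsub
    rw [hgen, hB, Finset.sum_mul]
    refine (norm_sum_le _ _).trans (Finset.sum_le_sum fun p hp => ?_)
    rw [norm_mul]
    by_cases hlt : p.1 < p.2
    · simp [entry_eq_zero A hlt]
    · rw [mul_assoc]
      rw [hP, Finset.mem_product, Finset.mem_Icc] at hp
      exact mul_le_mul_of_nonneg_left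
        (norm_normalOrd_le hp.1.1 (not_lt.1 hlt) hN hT) (norm_nonneg _)
  have hpow : ∀ n : ℕ, ∀ T ∈ Maya.window a b, ‖((gen A ^ n) f) T‖ ≤ B ^ n * M := by
    intro n
    induction n with
    | zero => simpa using hM
    | succ n ih =>
      intro T hT
      rw [pow_succ', Module.End.mul_apply, pow_succ', mul_assoc]
      exact key _ _ ih T hT
  refine Summable.of_norm_bounded ((Real.summable_pow_div_factorial B).mul_right M) fun n => ?_
  rw [norm_mul, norm_inv, Complex.norm_natCast, div_eq_inv_mul, mul_assoc]
  exact mul_le_mul_of_nonneg_left (hpow n S hS) (by positivity)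

/-! ### The pair correlator

The fields are `ψ(z) = ∑ ψ_i z ^ i` and `ψ*(w) = ∑ ψ*_i w ^ (-i - 1)`. -/

/-- The coefficient of `z ^ i` in `ψ(z)`. -/
def field (i : ℤ) : Fock →ₗ[ℂ] Fock := psi i

/-- The coefficient of `w ^ i` in `ψ*(w)`. -/
def fieldStar (i : ℤ) : Fock →ₗ[ℂ] Fock := psiStar (-i - 1)

/-- The coefficient of `z ^ a * w ^ b` in `⟨0|ψ(z) ψ*(w) ĝ|0⟩`. -/
def corrOut (A : LowerTri) (a b : ℤ) : ℂ :=
  braVac (field a (fieldStar b (groupOp A ketVac)))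

/-- The coefficient of `z ^ a * w ^ b` in `-⟨0|ψ*(w) ψ(z) ĝ|0⟩`. -/
def corrIn (A : LowerTri) (a b : ℤ) : ℂ :=
  -braVac (fieldStar b (field a (groupOp A ketVac)))

/-- The pair correlator at `t = 0` as a function: `⟨0|ψ(z) ψ*(w) ĝ|0⟩` for `|z| > |w|` and
`-⟨0|ψ*(w) ψ(z) ĝ|0⟩` for `|z| < |w|` (it is left undefined, here `0`, for `|z| = |w|`). -/
def pairCorr (A : LowerTri) (z w : ℂ) : ℂ :=
  if ‖w‖ < ‖z‖ then ∑' p : ℤ × ℤ, corrOut A p.1 p.2 * (z ^ p.1 * w ^ p.2)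
  else if ‖z‖ < ‖w‖ then ∑' p : ℤ × ℤ, corrIn A p.1 p.2 * (z ^ p.1 * w ^ p.2)
  else 0

end PairCorr

end

/-!
The proof rests on the identity of lower triangular matrices

`(⟨0|ψ_a ψ*_m ĝ|0⟩)_{m a} = g P g⁻¹`,

where `P` is the projection onto the span of the `e_i`, `i < 0`. The `(m, a)` entry of the right-hand
side is the finite sum of `g_{m k} (g⁻¹)_{k a}` over `a ≤ k ≤ m`, `k < 0`, and `k = -j` gives the sum
over the adapted bases. Since `ψ_a ψ*_m + ψ*_m ψ_a = δ_{a m}` and `⟨0|ĝ|0⟩ = 1`, exchanging the two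
fields replaces `P` by `P - 1`, which gives the second line.

The identity is obtained without conjugating operators by `ĝ`. Write `X = ∑ A_{ij} :ψ_i ψ*_j:`. As `A`
is lower triangular, `⟨0|X = 0`, so `⟨0|ψ_a ψ*_m X` is the vacuum value of the commutator
`[ψ_a ψ*_m, X]`. By the canonical anticommutation relations this means that if `C_f` is the matrix
`(⟨0|ψ_a ψ*_m f)_{m a}`, then `C_{X f} = [A, C_f]` (`pairBra_gen`). All the matrices `C_f` are lower
triangular, so that only finite sums occur. Starting from `C_{|0⟩} = P`, it follows that
`C_{ĝ|0⟩} = ∑ (ad A)^n P / n!`, which is `e^A P e^{-A}` by Cauchy products of entries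
(`hasSum_iterComm`). The same formula with `1` in place of `P` shows that `g⁻¹ = e^{-A}`
(`IsMatrixExp.neg`).

For the analytic statement, the bound on `|g_{k m}| |(g⁻¹)_{m i}|` makes the triple series over `j` and
the two exponents absolutely convergent, being dominated by a product of three geometric series
(`summable_triple`). Summing it in the two possible orders gives the two sides.
-/

noncomputable section

namespace PairCorr

/-! ### Canonical anticommutation relations -/

namespace Maya

theorem mem_add {S : Maya} {i k : ℤ} : k ∈ (S.add i).1 ↔ k = i ∨ k ∈ S.1 := by
  exact Iff.rfl

theorem mem_del {S : Maya} {i k : ℤ} : k ∈ (S.del i).1 ↔ k ∈ S.1 ∧ k ≠ i := by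
  exact Iff.rfl

theorem ext_mem {S T : Maya} (h : ∀ k, k ∈ S.1 ↔ k ∈ T.1) : S = T :=
  Subtype.ext (Set.ext h)

theorem add_del_of_notMem {S : Maya} {i : ℤ} (h : i ∉ S.1) : (S.add i).del i = S := by
  refine ext_mem fun k => ?_
  rw [mem_del, mem_add]
  by_cases hk : k = i
  · subst hk; simp [h]
  · simp [hk]

theorem del_add_of_mem {S : Maya} {i : ℤ} (h : i ∈ S.1) : (S.del i).add i = S := by
  refine ext_mem fun k => ?_
  rw [mem_add, mem_del]
  by_cases hk : k = i
  · subst hk; simp [h]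
  · simp [hk]

theorem del_del_comm (S : Maya) (i j : ℤ) : (S.del i).del j = (S.del j).del i :=
  ext_mem fun k => by simp only [mem_del]; tauto

theorem add_add_comm (S : Maya) (i j : ℤ) : (S.add i).add j = (S.add j).add i :=
  ext_mem fun k => by simp only [mem_add]; tauto

theorem del_add_comm (S : Maya) {i j : ℤ} (h : i ≠ j) : (S.del i).add j = (S.add j).del i :=
  ext_mem fun k => by
    simp only [mem_add, mem_del]
    constructor
    · rintro (rfl | hk)
      · exact ⟨Or.inl rfl, h.symm⟩
      · exact ⟨Or.inr hk.1, hk.2⟩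
    · rintro ⟨rfl | hk, h'⟩
      · exact Or.inl rfl
      · exact Or.inr ⟨hk, h'⟩

theorem sign_mul_self (S : Maya) (i : ℤ) : S.sign i * S.sign i = 1 := by
  unfold sign
  rw [← mul_pow]
  simp

theorem finite_above (S : Maya) (i : ℤ) : {k | k ∈ S.1 ∧ i < k}.Finite := by
  obtain ⟨a, b, -, hb⟩ := S.2
  refine (Set.finite_Icc i b).subset fun k hk => ⟨hk.2.le, ?_⟩
  by_contra h
  exact hb k (not_le.1 h).le hk.1

/-- Adding the site `j` shifts the wedge factors below it, which changes the sign exactly at the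
sites `i < j`. -/
theorem sign_add {S : Maya} {i j : ℤ} (hj : j ∉ S.1) :
    (S.add j).sign i = (if i < j then -1 else 1) * S.sign i := by
  unfold sign
  split_ifs with h
  · have : {k | k ∈ (S.add j).1 ∧ i < k} = insert j {k | k ∈ S.1 ∧ i < k} := by
      ext k
      simp only [Set.mem_ofPred_eq, mem_add, Set.mem_insert_iff]
      constructor
      · rintro ⟨rfl | hk, h'⟩
        · exact Or.inl rfl
        · exact Or.inr ⟨hk, h'⟩
      · rintro (rfl | hk)
        · exact ⟨Or.inl rfl, h⟩
        · exact ⟨Or.inr hk.1, hk.2⟩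
    rw [this, Set.ncard_insert_of_notMem (fun hk => hj hk.1) (S.finite_above i), pow_succ']
  · have : {k | k ∈ (S.add j).1 ∧ i < k} = {k | k ∈ S.1 ∧ i < k} := by
      ext k
      simp only [Set.mem_ofPred_eq, mem_add]
      constructor
      · rintro ⟨rfl | hk, h'⟩
        · exact absurd h' h
        · exact ⟨hk, h'⟩
      · exact fun hk => ⟨Or.inr hk.1, hk.2⟩
    rw [this, one_mul]

theorem sign_del {S : Maya} {i j : ℤ} (hj : j ∈ S.1) :
    (S.del j).sign i = (if i < j then -1 else 1) * S.sign i := by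
  have h := sign_add (S := S.del j) (i := i) (j := j) (fun h => h.2 rfl)
  rw [del_add_of_mem hj] at h
  rw [h]
  split_ifs <;> ring

end Maya

open Classical in
theorem psi_apply (i : ℤ) (f : Fock) (S : Maya) :
    psi i f S = if i ∈ S.1 then S.sign i * f (S.del i) else 0 := rfl

open Classical in
theorem psiStar_apply (i : ℤ) (f : Fock) (S : Maya) :
    psiStar i f S = if i ∈ S.1 then 0 else S.sign i * f (S.add i) := rfl

theorem psi_anticomm (i j : ℤ) (f : Fock) : psi i (psi j f) = -psi j (psi i f) := by
  funext S
  simp only [Pi.neg_apply, psi_apply]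
  by_cases hij : i = j
  · subst hij; simp [Maya.mem_del]
  by_cases hi : i ∈ S.1
  · by_cases hj : j ∈ S.1
    · simp only [Maya.mem_del, hi, hj, hij, Ne.symm hij, ne_eq, not_false_eq_true, and_self, if_true]
      rw [Maya.sign_del hi, Maya.sign_del hj, Maya.del_del_comm S i j]
      rcases lt_or_gt_of_ne hij with h | h
      · rw [if_neg h.not_gt, if_pos h]; ring
      · rw [if_pos h, if_neg h.not_gt]; ring
    · simp [Maya.mem_del, hj]
  · simp [Maya.mem_del, hi]

theorem psiStar_anticomm (i j : ℤ) (f : Fock) :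
    psiStar i (psiStar j f) = -psiStar j (psiStar i f) := by
  funext S
  simp only [Pi.neg_apply, psiStar_apply]
  by_cases hij : i = j
  · subst hij; simp [Maya.mem_add]
  by_cases hi : i ∈ S.1
  · simp [Maya.mem_add, hi]
  · by_cases hj : j ∈ S.1
    · simp [Maya.mem_add, hj]
    · simp only [Maya.mem_add, hi, hj, hij, Ne.symm hij, or_self, if_false]
      rw [Maya.sign_add hi, Maya.sign_add hj, Maya.add_add_comm S i j]
      rcases lt_or_gt_of_ne hij with h | h
      · rw [if_neg h.not_gt, if_pos h]; ring
      · rw [if_pos h, if_neg h.not_gt]; ring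

theorem psiStar_psi (i j : ℤ) (f : Fock) :
    psiStar j (psi i f) = (if i = j then (1 : ℂ) else 0) • f - psi i (psiStar j f) := by
  funext S
  simp only [Pi.sub_apply, Pi.smul_apply, smul_eq_mul, psi_apply, psiStar_apply]
  by_cases hij : i = j
  · subst hij
    by_cases hi : i ∈ S.1
    · simp only [Maya.mem_add, Maya.mem_del, hi, ne_eq, not_true_eq_false, and_false, if_true, if_false]
      rw [Maya.sign_del hi, Maya.del_add_of_mem hi, if_neg (lt_irrefl i)]
      linear_combination f S * S.sign_mul_self i
    · simp only [Maya.mem_add, Maya.mem_del, hi, true_or, if_true, if_false]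
      rw [Maya.sign_add hi, Maya.add_del_of_notMem hi, if_neg (lt_irrefl i)]
      linear_combination f S * S.sign_mul_self i
  · by_cases hj : j ∈ S.1
    · simp [Maya.mem_del, hj, hij, Ne.symm hij]
    · by_cases hi : i ∈ S.1
      · simp only [Maya.mem_add, Maya.mem_del, hi, hj, hij, or_true, false_and, if_true, if_false]
        rw [Maya.sign_add hj, Maya.sign_del hi, Maya.del_add_comm S hij]
        rcases lt_or_gt_of_ne hij with h | h
        · rw [if_neg h.not_gt, if_pos h]; ring
        · rw [if_pos h, if_neg h.not_gt]; ring
      · simp [Maya.mem_add, hi, hj, hij]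

/-! ### The pair functional of the left vacuum -/

/-- The functional `⟨0|ψ_a ψ*_m`. -/
def pairBra (a m : ℤ) (f : Fock) : ℂ := braVac (psi a (psiStar m f))

theorem mem_vac {k : ℤ} : k ∈ Maya.vac.1 ↔ k < 0 := Iff.rfl

/-- `ψ_a` and `ψ*_m` send basis vectors to multiples of basis vectors, so the functional
`⟨0|ψ_a ψ*_m` reads off a multiple of a single coefficient. In particular it commutes with all
coefficientwise convergent sums. -/
theorem exists_pairBra_eq_mul (a m : ℤ) : ∃ (c : ℂ) (T : Maya), ∀ f, pairBra a m f = c * f T := by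
  by_cases ha : a ∈ Maya.vac.1
  · by_cases hm : m ∈ (Maya.vac.del a).1
    · exact ⟨0, Maya.vac, fun f => by simp [pairBra, braVac, psi_apply, psiStar_apply, hm]⟩
    · exact ⟨Maya.vac.sign a * (Maya.vac.del a).sign m, (Maya.vac.del a).add m, fun f => by
        simp [pairBra, braVac, psi_apply, psiStar_apply, hm, ha, mul_assoc]⟩
  · exact ⟨0, Maya.vac, fun f => by simp [pairBra, braVac, psi_apply, ha]⟩

/-- The matrix `(⟨0|ψ_a ψ*_m f)_{m a}` is lower triangular. -/
theorem pairBra_eq_zero {a m : ℤ} (h : m < a) (f : Fock) : pairBra a m f = 0 := by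
  simp only [pairBra, braVac, psi_apply, psiStar_apply, Maya.mem_del, mem_vac]
  split_ifs with h1 h2
  · simp
  · exact absurd ⟨h.trans h1, h.ne⟩ h2
  · rfl

theorem pairBra_ketVac (a m : ℤ) :
    pairBra a m ketVac = if m = a ∧ m < 0 then 1 else 0 := by
  simp only [pairBra, braVac, psi_apply, psiStar_apply, Maya.mem_del, mem_vac]
  by_cases ha : a < 0
  · by_cases hma : m = a
    · subst hma
      have hm : m ∈ Maya.vac.1 := ha
      simp only [ha, ne_eq, not_true_eq_false, and_false, if_true, if_false, and_self]
      rw [Maya.sign_del hm, Maya.del_add_of_mem hm, if_neg (lt_irrefl m), ketVac, if_pos rfl]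
      linear_combination Maya.vac.sign_mul_self m
    · have hne : (Maya.vac.del a).add m ≠ Maya.vac := fun h => by
        have : a ∈ ((Maya.vac.del a).add m).1 := h.symm ▸ mem_vac.2 ha
        rcases this with h' | h'
        · exact hma h'.symm
        · exact h'.2 rfl
      simp [hma, ketVac, hne]
  · have : ¬ (m = a ∧ m < 0) := fun h => ha (h.1 ▸ h.2)
    simp [ha, this]

/-- The left vacuum is annihilated by the raising operators `:ψ_i ψ*_j:`, `j ≤ i`. -/
theorem braVac_normalOrd {i j : ℤ} (h : j ≤ i) (f : Fock) : braVac (normalOrd i j f) = 0 := by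
  simp only [normalOrd, braVac, LinearMap.sub_apply, LinearMap.comp_apply, LinearMap.smul_apply,
    LinearMap.id_apply, Pi.sub_apply, Pi.smul_apply, smul_eq_mul, psi_apply, psiStar_apply,
    Maya.mem_del, mem_vac]
  by_cases hi : i < 0
  · by_cases hij : i = j
    · subst hij
      have hm : i ∈ Maya.vac.1 := hi
      simp only [hi, ne_eq, not_true_eq_false, and_false, if_true, if_false, and_self]
      rw [Maya.sign_del hm, Maya.del_add_of_mem hm, if_neg (lt_irrefl i)]
      linear_combination f Maya.vac * Maya.vac.sign_mul_self i
    · simp [hij, Ne.symm hij, hi, h.trans_lt hi]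
  · simp [hi]

theorem normalOrd_apply (i j : ℤ) (f : Fock) :
    normalOrd i j f = psi i (psiStar j f) - (if i = j ∧ i < 0 then (1 : ℂ) else 0) • f := rfl

/-- `⟨0|ψ_a ψ*_m :ψ_i ψ*_j:` is the vacuum value of the commutator of `ψ_a ψ*_m` and `ψ_i ψ*_j`. -/
theorem pairBra_normalOrd (a m : ℤ) {i j : ℤ} (h : j ≤ i) (f : Fock) :
    pairBra a m (normalOrd i j f) =
      (if i = m then pairBra a j f else 0) - (if j = a then pairBra i m f else 0) := by
  have h0 : braVac (psi i (psiStar j (psi a (psiStar m f)))) =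
      (if i = j ∧ i < 0 then (1 : ℂ) else 0) * pairBra a m f := by
    have := braVac_normalOrd h (psi a (psiStar m f))
    rw [normalOrd_apply] at this
    exact sub_eq_zero.1 this
  have h1 : psi a (psiStar m (psi i (psiStar j f))) =
      (if i = m then (1 : ℂ) else 0) • psi a (psiStar j f)
        - (if a = j then (1 : ℂ) else 0) • psi i (psiStar m f)
        + psi i (psiStar j (psi a (psiStar m f))) := by
    rw [psiStar_psi i m, map_sub, map_smul, psi_anticomm a i, psiStar_anticomm m j, map_neg,
      map_neg, neg_neg, psiStar_psi a j, map_sub, map_smul]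
    abel
  have h2 : pairBra a m (normalOrd i j f) = braVac (psi a (psiStar m (psi i (psiStar j f)))) -
      (if i = j ∧ i < 0 then (1 : ℂ) else 0) * pairBra a m f := by
    rw [pairBra, normalOrd_apply, map_sub, map_sub, map_smul, map_smul]
    rfl
  have h3 : ∀ x y u : Fock, ∀ c d : ℂ, braVac (c • x - d • y + u) =
      c * braVac x - d * braVac y + braVac u := fun _ _ _ _ _ => rfl
  rw [h2, h1, h3, h0, add_sub_cancel_right]
  simp only [pairBra, ite_mul, one_mul, zero_mul, eq_comm (a := a)]

/-- The left vacuum is annihilated by `∑ A_{ij} :ψ_i ψ*_j:`. -/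
theorem braVac_gen (A : LowerTri) (f : Fock) : braVac (gen A f) = 0 := by
  change (∑ᶠ p : ℤ × ℤ, entry A p.1 p.2 * normalOrd p.1 p.2 f Maya.vac) = 0
  rw [← finsum_zero (α := ℤ × ℤ)]
  refine finsum_congr fun p => ?_
  rcases lt_or_ge p.1 p.2 with h | h
  · rw [entry_eq_zero A h, zero_mul]
  · have : normalOrd p.1 p.2 f Maya.vac = 0 := braVac_normalOrd h f
    rw [this, mul_zero]

/-- On the matrices `C_f = (⟨0|ψ_a ψ*_m f)_{m a}`, the operator `∑ A_{ij} :ψ_i ψ*_j:` acts as the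
commutator with `A`. -/
theorem pairBra_gen (A : LowerTri) (f : Fock) (a m : ℤ) :
    pairBra a m (gen A f) = (∑ k ∈ Finset.Icc a m, entry A m k * pairBra a k f) -
      ∑ k ∈ Finset.Icc a m, pairBra k m f * entry A k a := by
  obtain ⟨c, T, hc⟩ := exists_pairBra_eq_mul a m
  -- Only the row `i = m` and the column `j = a` contribute, in the range `a ≤ i, j ≤ m`.
  have hterm : ∀ p : ℤ × ℤ, c * (entry A p.1 p.2 * normalOrd p.1 p.2 f T) =
      (if p.1 = m then entry A m p.2 * pairBra a p.2 f else 0) -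
        (if p.2 = a then pairBra p.1 m f * entry A p.1 a else 0) := by
    rintro ⟨i, j⟩
    simp only
    rcases lt_or_ge i j with h | h
    · rw [entry_eq_zero A h]
      split_ifs with h1 h2 h2
      · subst h1 h2; simp [entry_eq_zero A h]
      · subst h1; simp [entry_eq_zero A h]
      · subst h2; simp [entry_eq_zero A h]
      · simp
    · rw [mul_left_comm, ← hc, pairBra_normalOrd a m h f]
      split_ifs with h1 h2 h2
      · subst h1 h2; ring
      · subst h1; ring
      · subst h2; ring
      · ring
  have hsupp : (Function.support fun p : ℤ × ℤ =>
      c * (entry A p.1 p.2 * normalOrd p.1 p.2 f T)) ⊆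
        ((Finset.Icc a m ×ˢ Finset.Icc a m : Finset (ℤ × ℤ)) : Set (ℤ × ℤ)) := by
    rintro ⟨i, j⟩ hp
    by_contra hcon
    apply hp
    simp only [Finset.coe_product, Finset.coe_Icc, Set.mem_prod, Set.mem_Icc] at hcon
    refine (hterm (i, j)).trans ?_
    simp only
    have h1 : (if i = m then entry A m j * pairBra a j f else 0) = 0 := by
      split_ifs with h
      · rcases lt_or_ge j a with h' | h'
        · rw [pairBra_eq_zero h', mul_zero]
        · rw [entry_eq_zero A (show m < j by omega), zero_mul]
      · rfl
    have h2 : (if j = a then pairBra i m f * entry A i a else 0) = 0 := by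
      split_ifs with h
      · rcases lt_or_ge m i with h' | h'
        · rw [pairBra_eq_zero h', zero_mul]
        · rw [entry_eq_zero A (show i < a by omega), mul_zero]
      · rfl
    rw [h1, h2, sub_zero]
  rw [hc]
  change c * (∑ᶠ p : ℤ × ℤ, entry A p.1 p.2 * normalOrd p.1 p.2 f T) = _
  rw [mul_finsum' _ _ (finite_support_gen A f T), finsum_eq_sum_of_support_subset _ hsupp,
    Finset.sum_congr rfl fun p _ => hterm p, Finset.sum_sub_distrib, Finset.sum_product_right,
    Finset.sum_product]
  rcases lt_or_ge m a with h | h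
  · simp [Finset.Icc_eq_empty_of_lt h]
  · simp [h]

/-! ### Conjugation by a matrix exponential -/

theorem entry_ext {X Y : LowerTri} (h : ∀ i j, entry X i j = entry Y i j) : X = Y :=
  IncidenceAlgebra.ext fun i j _ => h (OrderDual.ofDual i) (OrderDual.ofDual j)

theorem entry_one (i j : ℤ) : entry 1 i j = if i = j then 1 else 0 := by
  simp [entry, IncidenceAlgebra.one_apply]

theorem entry_sub (X Y : LowerTri) (i j : ℤ) : entry (X - Y) i j = entry X i j - entry Y i j := rfl

/-- The `(i, j)` matrix entry as an additive map. -/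
def entryHom (i j : ℤ) : LowerTri →+ ℂ where
  toFun X := entry X i j
  map_zero' := rfl
  map_add' _ _ := rfl

theorem entryHom_apply (i j : ℤ) (X : LowerTri) : entryHom i j X = entry X i j := rfl

/-- The lower triangular matrix with prescribed entries. -/
def ofEntries (f : ℤ → ℤ → ℂ) (h : ∀ i j, i < j → f i j = 0) : LowerTri where
  toFun i j := f (OrderDual.ofDual i) (OrderDual.ofDual j)
  eq_zero_of_not_le' i j hij := h _ _ (by
    rw [← not_le]
    exact hij)

theorem entry_ofEntries (f : ℤ → ℤ → ℂ) (h : ∀ i j, i < j → f i j = 0) (i j : ℤ) :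
    entry (ofEntries f h) i j = f i j := rfl

/-- The `n`-fold commutator `(ad A) ^ n X`. -/
def iterComm {R : Type*} [Ring R] (A X : R) : ℕ → R
  | 0 => X
  | n + 1 => A * iterComm A X n - iterComm A X n * A

/-- `ad A` is the sum of the commuting operators `X ↦ A X` and `X ↦ X (-A)`. -/
theorem iterComm_eq_sum {R : Type*} [Ring R] (A X : R) (n : ℕ) :
    iterComm A X n = ∑ p ∈ Finset.HasAntidiagonal.antidiagonal n, n.choose p.1 • (A ^ p.1 * X * (-A) ^ p.2) := by
  have hiter : iterComm A X n =
      ((LinearMap.mulLeft ℤ A + LinearMap.mulRight ℤ (-A)) ^ n) X := by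
    induction n with
    | zero => rfl
    | succ n ih =>
      rw [pow_succ', Module.End.mul_apply, ← ih, iterComm, sub_eq_add_neg, ← mul_neg]
      rfl
  rw [hiter, (LinearMap.commute_mulLeft_right A (-A)).add_pow', LinearMap.sum_apply]
  refine Finset.sum_congr rfl fun p _ => ?_
  rw [LinearMap.smul_apply, Module.End.mul_apply, LinearMap.pow_mulLeft, LinearMap.pow_mulRight,
    LinearMap.mulLeft_apply, LinearMap.mulRight_apply, mul_assoc]

theorem IsMatrixExp.hasSum_mul {A g : LowerTri} (hg : IsMatrixExp A g) (X : LowerTri) (i j : ℤ) :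
    HasSum (fun n : ℕ => ((n.factorial : ℂ))⁻¹ * entry (A ^ n * X) i j) (entry (g * X) i j) := by
  simp only [entry_mul, Finset.mul_sum, ← mul_assoc]
  exact hasSum_sum fun k _ => (hg i k).mul_right _

theorem hasSum_cauchyProduct {u v : ℕ → ℂ} {U V : ℂ} (hu : HasSum u U) (hv : HasSum v V) :
    HasSum (fun n => ∑ p ∈ Finset.HasAntidiagonal.antidiagonal n, u p.1 * v p.2) (U * V) := by
  have hu' := summable_norm_iff.2 hu.summable
  have hv' := summable_norm_iff.2 hv.summable
  have h := tsum_mul_tsum_eq_tsum_sum_antidiagonal_of_summable_norm hu' hv'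
  rw [hu.tsum_eq, hv.tsum_eq] at h
  rw [h]
  exact (summable_norm_sum_mul_antidiagonal_of_summable_norm hu' hv').of_norm.hasSum

/-- `e^A X e^{-A} = ∑ (ad A)^n X / n!`, entry by entry. -/
theorem hasSum_iterComm {A g h : LowerTri} (hg : IsMatrixExp A g) (hh : IsMatrixExp (-A) h)
    (X : LowerTri) (i j : ℤ) :
    HasSum (fun n : ℕ => ((n.factorial : ℂ))⁻¹ * entry (iterComm A X n) i j)
      (entry (g * X * h) i j) := by
  have key : HasSum (fun n : ℕ => ∑ k ∈ Finset.Icc j i, ∑ p ∈ Finset.HasAntidiagonal.antidiagonal n,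
      (((p.1.factorial : ℂ))⁻¹ * entry (A ^ p.1 * X) i k) *
        (((p.2.factorial : ℂ))⁻¹ * entry ((-A) ^ p.2) k j)) (entry (g * X * h) i j) := by
    have hk := fun k => hasSum_cauchyProduct (hg.hasSum_mul X i k) (hh k j)
    rw [entry_mul]
    exact hasSum_sum fun k _ => hk k
  refine key.congr_fun fun n => ?_
  rw [Finset.sum_comm, iterComm_eq_sum, ← entryHom_apply, map_sum, Finset.mul_sum]
  refine Finset.sum_congr rfl fun p hp => ?_
  rw [map_nsmul, entryHom_apply, entry_mul, nsmul_eq_mul, Finset.mul_sum, Finset.mul_sum]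
  refine Finset.sum_congr rfl fun k _ => ?_
  rw [Finset.HasAntidiagonal.mem_antidiagonal] at hp
  have h1 : (n.choose p.1 : ℂ) * (p.1.factorial : ℂ) * (p.2.factorial : ℂ) = n.factorial := by
    have := Nat.choose_mul_factorial_mul_factorial (show p.1 ≤ n by omega)
    rw [show n - p.1 = p.2 by omega] at this
    exact_mod_cast this
  have h2 : (n.factorial : ℂ) ≠ 0 := by exact_mod_cast n.factorial_ne_zero
  have h3 : (p.1.factorial : ℂ) ≠ 0 := by exact_mod_cast p.1.factorial_ne_zero
  have h4 : (p.2.factorial : ℂ) ≠ 0 := by exact_mod_cast p.2.factorial_ne_zero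
  field_simp
  rw [← h1]
  ring

theorem IsMatrixExp.exists_neg {A g : LowerTri} (hg : IsMatrixExp A g) :
    ∃ h, IsMatrixExp (-A) h := by
  refine ⟨ofEntries (fun i j => ∑' n : ℕ, ((n.factorial : ℂ))⁻¹ * entry ((-A) ^ n) i j)
    fun i j hij => by simp [entry_eq_zero _ hij], fun i j => ?_⟩
  rw [entry_ofEntries]
  refine Summable.hasSum (Summable.of_norm ?_)
  refine (summable_norm_iff.2 (hg i j).summable).congr fun n => ?_
  rw [norm_mul, norm_mul, neg_pow A]
  rcases neg_one_pow_eq_or LowerTri n with h | h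
  · rw [h, one_mul]
  · rw [h, neg_one_mul, ← entryHom_apply i j (-A ^ n), map_neg, norm_neg, entryHom_apply]

/-- The inverse of `e^A` is `e^{-A}`: the expansion of `e^A X e^{-A}` in iterated commutators
reduces to its first term for `X = 1`. -/
theorem IsMatrixExp.neg {A : LowerTri} {g : LowerTriˣ} (hg : IsMatrixExp A (g : LowerTri)) :
    IsMatrixExp (-A) ((g⁻¹ : LowerTriˣ) : LowerTri) := by
  obtain ⟨h, hh⟩ := hg.exists_neg
  have hone : ∀ n, iterComm A 1 (n + 1) = 0 := by
    intro n
    induction n with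
    | zero => simp [iterComm]
    | succ n ih => rw [iterComm, ih, mul_zero, zero_mul, sub_zero]
  have hgh : (g : LowerTri) * h = 1 := by
    refine entry_ext fun i j => ?_
    have h1 := hasSum_iterComm hg hh 1 i j
    rw [mul_one] at h1
    refine h1.unique ?_
    have h2 := hasSum_single (f := fun n : ℕ =>
      ((n.factorial : ℂ))⁻¹ * entry (iterComm A 1 n) i j) 0 (by
        intro n hn
        obtain ⟨k, rfl⟩ := Nat.exists_eq_succ_of_ne_zero hn
        simp only [Nat.succ_eq_add_one, hone]
        exact mul_zero _)
    simpa [iterComm] using h2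
  rwa [Units.inv_eq_of_mul_eq_one_right hgh]

/-! ### The vacuum expectation values -/

/-- The projection onto the span of the `e_i` with `i < 0`. -/
def seaProj : LowerTri :=
  ofEntries (fun i j => if i = j ∧ i < 0 then 1 else 0) fun _ _ h => if_neg fun h' => h.ne h'.1

theorem pairBra_gen_pow (A : LowerTri) (n : ℕ) (a m : ℤ) :
    pairBra a m ((gen A ^ n) ketVac) = entry (iterComm A seaProj n) m a := by
  induction n generalizing a m with
  | zero =>
    rw [pow_zero, Module.End.one_apply, pairBra_ketVac]
    rfl
  | succ n ih =>
    rw [pow_succ', Module.End.mul_apply, pairBra_gen, iterComm, entry_sub, entry_mul, entry_mul]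
    simp only [ih]

/-- `⟨0|ψ_a ψ*_m ĝ|0⟩` is the `(m, a)` entry of `g P g⁻¹`, with `P` the projection onto the
Dirac sea. -/
theorem pairBra_groupOp {A : LowerTri} {g : LowerTriˣ} (hg : IsMatrixExp A (g : LowerTri))
    (a m : ℤ) : pairBra a m (groupOp A ketVac) =
      entry ((g : LowerTri) * seaProj * ((g⁻¹ : LowerTriˣ) : LowerTri)) m a := by
  obtain ⟨c, T, hc⟩ := exists_pairBra_eq_mul a m
  have h1 := (summable_groupOp A ketVac T).hasSum.mul_left c
  have h2 := hasSum_iterComm hg hg.neg seaProj m a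
  rw [hc]
  refine h1.unique (h2.congr_fun fun n => ?_)
  rw [← pairBra_gen_pow, hc]
  ring

theorem braVac_groupOp (A : LowerTri) : braVac (groupOp A ketVac) = 1 := by
  change (∑' n : ℕ, ((n.factorial : ℂ))⁻¹ * ((gen A ^ n) ketVac) Maya.vac) = 1
  rw [tsum_eq_single 0]
  · simp [ketVac]
  · intro n hn
    obtain ⟨k, rfl⟩ := Nat.exists_eq_succ_of_ne_zero hn
    rw [Nat.succ_eq_add_one, pow_succ', Module.End.mul_apply]
    have : gen A ((gen A ^ k) ketVac) Maya.vac = 0 := braVac_gen A _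
    rw [this, mul_zero]

theorem corrOut_eq_entry {A : LowerTri} {g : LowerTriˣ} (hg : IsMatrixExp A (g : LowerTri))
    (a b : ℤ) : corrOut A a b =
      entry ((g : LowerTri) * seaProj * ((g⁻¹ : LowerTriˣ) : LowerTri)) (-b - 1) a :=
  pairBra_groupOp hg a (-b - 1)

/-- Exchanging the two fields replaces the projection `P` by `P - 1`. -/
theorem corrIn_eq_neg_entry {A : LowerTri} {g : LowerTriˣ} (hg : IsMatrixExp A (g : LowerTri))
    (a b : ℤ) : corrIn A a b =
      -entry ((g : LowerTri) * (1 - seaProj) * ((g⁻¹ : LowerTriˣ) : LowerTri)) (-b - 1) a := by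
  have h1 : corrIn A a b = pairBra a (-b - 1) (groupOp A ketVac) -
      (if a = -b - 1 then 1 else 0) * braVac (groupOp A ketVac) := by
    rw [corrIn, fieldStar, field, psiStar_psi]
    exact neg_sub _ _
  rw [h1, pairBra_groupOp hg, braVac_groupOp, mul_one, mul_sub, mul_one, sub_mul, Units.mul_inv,
    entry_sub, entry_one, neg_sub]
  simp only [eq_comm]

theorem entry_mul_seaProj_mul (X Y : LowerTri) (i j : ℤ) :
    entry (X * seaProj * Y) i j =
      ∑ k ∈ Finset.Icc j i, if k < 0 then entry X i k * entry Y k j else 0 := by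
  rw [entry_mul]
  refine Finset.sum_congr rfl fun k hk => ?_
  have h : entry (X * seaProj) i k = if k < 0 then entry X i k else 0 := by
    rw [entry_mul, Finset.sum_eq_single k]
    · by_cases hk0 : k < 0 <;> simp [seaProj, entry_ofEntries, hk0]
    · intro l _ hl
      simp [seaProj, entry_ofEntries, hl]
    · intro h
      exact absurd (Finset.mem_Icc.2 ⟨le_rfl, (Finset.mem_Icc.1 hk).2⟩) h
  rw [h, ite_mul, zero_mul]

theorem entry_mul_one_sub_seaProj_mul (X Y : LowerTri) (i j : ℤ) :
    entry (X * (1 - seaProj) * Y) i j =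
      ∑ k ∈ Finset.Icc j i, if 0 ≤ k then entry X i k * entry Y k j else 0 := by
  rw [mul_sub, mul_one, sub_mul, entry_sub, entry_mul_seaProj_mul, entry_mul,
    ← Finset.sum_sub_distrib]
  refine Finset.sum_congr rfl fun k _ => ?_
  by_cases h : k < 0
  · simp [h, not_le.2 h]
  · simp [h, not_lt.1 h]

/-! ### Coefficients of the sums over adapted bases -/

theorem adapted_mul_adaptedDual (g : LowerTriˣ) {c d : ℤ} (hd : d = -c + 1) (a b : ℤ) :
    adapted g c b * adaptedDual g d a =
      entry (g : LowerTri) (-b - 1) (-c) * entry ((g⁻¹ : LowerTriˣ) : LowerTri) (-c) a := by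
  rw [adapted_apply, adaptedDual_apply, hd, add_sub_cancel_right]

theorem finite_support_adapted (g : LowerTriˣ) {c d : ℕ+ → ℤ} (hc : Function.Injective c)
    (hd : ∀ j, d j = -c j + 1) (a b : ℤ) :
    (Function.support fun j => adapted g (c j) b * adaptedDual g (d j) a).Finite := by
  refine ((Set.finite_Icc (b + 1) (-a)).preimage hc.injOn).subset fun j hj => ?_
  by_contra h
  apply hj
  change adapted g (c j) b * adaptedDual g (d j) a = 0
  rw [adapted_mul_adaptedDual g (hd j)]
  rw [Set.mem_preimage, Set.mem_Icc, not_and_or] at h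
  rcases h with h | h
  · rw [entry_eq_zero _ (show -b - 1 < -c j by omega), zero_mul]
  · rw [entry_eq_zero ((g⁻¹ : LowerTriˣ) : LowerTri) (show -c j < a by omega), mul_zero]

/-- The products of adapted basis elements whose indices `c j`, `d j` add up to `1` contribute the
terms of the matrix product `g g⁻¹` with intermediate index `k = -c j`; the predicate `p` describes
the indices that occur. -/
theorem finsum_adapted (g : LowerTriˣ) {c d : ℕ+ → ℤ} (hc : Function.Injective c)
    (hd : ∀ j, d j = -c j + 1) (p : ℤ → Prop) [DecidablePred p]
    (hp : ∀ k, p k ↔ ∃ j, -c j = k) (a b : ℤ) :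
    (∑ᶠ j, adapted g (c j) b * adaptedDual g (d j) a) =
      ∑ k ∈ Finset.Icc a (-b - 1), if p k then
        entry (g : LowerTri) (-b - 1) k * entry ((g⁻¹ : LowerTriˣ) : LowerTri) k a else 0 := by
  have hinj : Function.Injective fun j => -c j := neg_injective.comp hc
  rw [finsum_congr fun j => adapted_mul_adaptedDual g (hd j) a b,
    ← finsum_mem_range (f := fun k =>
      entry (g : LowerTri) (-b - 1) k * entry ((g⁻¹ : LowerTriˣ) : LowerTri) k a) hinj,
    ← finsum_eq_sum_of_support_subset]
  · refine finsum_congr fun k => ?_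
    classical
    rw [finsum_eq_if]
    simp only [hp, Set.mem_range]
  · intro k hk
    rw [Finset.coe_Icc]
    by_contra h
    apply hk
    rw [Set.mem_Icc, not_and_or] at h
    refine ite_eq_right_iff.2 fun _ => ?_
    rcases h with h | h
    · rw [entry_eq_zero ((g⁻¹ : LowerTriˣ) : LowerTri) (show k < a by omega), mul_zero]
    · rw [entry_eq_zero _ (show -b - 1 < k by omega), zero_mul]

theorem injective_pnat_cast : Function.Injective fun j : ℕ+ => (j : ℤ) := fun i j h => by
  simpa using h

theorem injective_neg_pnat_cast_add_one : Function.Injective fun j : ℕ+ => -(j : ℤ) + 1 :=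
  fun i j h => injective_pnat_cast (by simpa using h)

theorem corrOut_eq_finsum {A : LowerTri} {g : LowerTriˣ} (hg : IsMatrixExp A (g : LowerTri))
    (a b : ℤ) : corrOut A a b =
      ∑ᶠ j : ℕ+, adapted g (j : ℤ) b * adaptedDual g (-(j : ℤ) + 1) a := by
  rw [corrOut_eq_entry hg, entry_mul_seaProj_mul,
    finsum_adapted g injective_pnat_cast (fun _ => rfl) (fun k => k < 0)]
  intro k
  refine ⟨fun hk => ⟨⟨(-k).toNat, by omega⟩, ?_⟩, ?_⟩
  · simp only [PNat.mk_coe]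
    omega
  · rintro ⟨j, rfl⟩
    have := j.pos
    omega

theorem corrIn_eq_finsum {A : LowerTri} {g : LowerTriˣ} (hg : IsMatrixExp A (g : LowerTri))
    (a b : ℤ) : corrIn A a b =
      -∑ᶠ j : ℕ+, adapted g (-(j : ℤ) + 1) b * adaptedDual g (j : ℤ) a := by
  rw [corrIn_eq_neg_entry hg, entry_mul_one_sub_seaProj_mul,
    finsum_adapted g injective_neg_pnat_cast_add_one (fun _ => by ring) (fun k => 0 ≤ k)]
  intro k
  refine ⟨fun hk => ⟨⟨(k + 1).toNat, by omega⟩, ?_⟩, ?_⟩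
  · simp only [PNat.mk_coe]
    omega
  · rintro ⟨j, rfl⟩
    have := j.pos
    omega

/-! ### Convergence -/

/-- The geometric sequence `r ^ n`, `n ≥ 0`, extended by zero to all integers. -/
def geomTail (r : ℝ) (n : ℤ) : ℝ := if 0 ≤ n then r ^ n else 0

theorem geomTail_nonneg {r : ℝ} (hr : 0 ≤ r) (n : ℤ) : 0 ≤ geomTail r n := by
  unfold geomTail
  split_ifs
  · exact zpow_nonneg hr n
  · exact le_rfl

theorem summable_geomTail {r : ℝ} (h0 : 0 ≤ r) (h1 : r < 1) : Summable (geomTail r) := by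
  refine (Function.Injective.summable_iff (Nat.cast_injective (R := ℤ)) ?_).1 ?_
  · intro n hn
    refine if_neg fun h => hn ⟨n.toNat, ?_⟩
    omega
  · refine (summable_geometric_of_lt_one h0 h1).congr fun n => ?_
    simp [geomTail]

/-- A series in descending powers of `z` with coefficients `O(R ^ (-j))` converges for `|z| > R`. -/
theorem summable_mul_zpow {f : ℤ → ℂ} {N : ℤ} {D R : ℝ} (hR : 0 < R)
    (hf : ∀ j, j ≤ N → ‖f j‖ ≤ D * R ^ (N - j)) (hf0 : ∀ j, N < j → f j = 0) {z : ℂ}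
    (hz : R < ‖z‖) : Summable fun j => f j * z ^ j := by
  have hz0 : 0 < ‖z‖ := hR.trans hz
  have hs := ((Equiv.subLeft N).summable_iff.2
    (summable_geomTail (div_nonneg hR.le hz0.le) ((div_lt_one hz0).2 hz))).mul_left (D * ‖z‖ ^ N)
  refine Summable.of_norm_bounded hs fun j => ?_
  simp only [Function.comp_apply, Equiv.subLeft_apply]
  rcases lt_or_ge N j with h | h
  · rw [hf0 j h, geomTail, if_neg (by omega)]
    simp
  · rw [geomTail, if_pos (by omega), norm_mul, norm_zpow]
    calc ‖f j‖ * ‖z‖ ^ j ≤ D * R ^ (N - j) * ‖z‖ ^ j :=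
          mul_le_mul_of_nonneg_right (hf j h) (zpow_nonneg hz0.le _)
      _ = D * ‖z‖ ^ N * (R / ‖z‖) ^ (N - j) := by
          rw [div_zpow, zpow_sub₀ hz0.ne' N j]
          have := (zpow_pos hz0 N).ne'
          have := (zpow_pos hz0 j).ne'
          field_simp

theorem entry_diag_ne_zero (g : LowerTriˣ) (i : ℤ) : entry (g : LowerTri) i i ≠ 0 := by
  intro h
  have h1 : entry ((g : LowerTri) * ((g⁻¹ : LowerTriˣ) : LowerTri)) i i = 1 := by
    rw [Units.mul_inv, entry_one, if_pos rfl]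
  rw [entry_mul, Finset.Icc_self, Finset.sum_singleton, h, zero_mul] at h1
  exact zero_ne_one h1

/-- Fubini for an absolutely convergent double series. -/
theorem hasSum_of_hasSum_fiberwise {α β : Type*} {T : α × β → ℂ} (hT : Summable T) {u : β → ℂ}
    {v : α → ℂ} (hu : ∀ p, HasSum (fun j => T (j, p)) (u p))
    (hv : ∀ j, HasSum (fun p => T (j, p)) (v j)) :
    Summable u ∧ HasSum v (∑' p, u p) := by
  have hswap : HasSum u (∑' q, T q) :=
    (((Equiv.prodComm β α).hasSum_iff).2 hT.hasSum).prod_fiberwise hu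
  refine ⟨hswap.summable, ?_⟩
  rw [hswap.tsum_eq]
  exact hT.hasSum.prod_fiberwise hv

section Bound

variable {g : LowerTriˣ} {R C : ℝ} (hR : 0 < R)
  (hb : ∀ i m k : ℤ, i ≤ m → m ≤ k →
    ‖entry (g : LowerTri) k m‖ * ‖entry ((g⁻¹ : LowerTriˣ) : LowerTri) m i‖ ≤ C * R ^ (k - i))
include hR hb

theorem summable_adapted (k : ℤ) {z : ℂ} (hz : R < ‖z‖) :
    Summable fun j => adapted g k j * z ^ j := by
  have hd : 0 < ‖entry ((g⁻¹ : LowerTriˣ) : LowerTri) (-k) (-k)‖ :=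
    norm_pos_iff.2 (entry_diag_ne_zero g⁻¹ (-k))
  refine summable_mul_zpow (N := k - 1)
    (D := C / ‖entry ((g⁻¹ : LowerTriˣ) : LowerTri) (-k) (-k)‖) hR (fun j hj => ?_)
    (fun j hj => ?_) hz
  -- the bound on products, applied with a diagonal entry of `g⁻¹`
  · rw [adapted_apply, div_mul_eq_mul_div, le_div_iff₀ hd]
    have := hb (-k) (-k) (-j - 1) le_rfl (by omega)
    rwa [show -j - 1 - -k = k - 1 - j by ring] at this
  · rw [adapted_apply, entry_eq_zero _ (by omega)]

theorem summable_adaptedDual (k : ℤ) {z : ℂ} (hz : R < ‖z‖) :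
    Summable fun j => adaptedDual g k j * z ^ j := by
  have hd : 0 < ‖entry (g : LowerTri) (k - 1) (k - 1)‖ :=
    norm_pos_iff.2 (entry_diag_ne_zero g (k - 1))
  refine summable_mul_zpow (N := k - 1)
    (D := C / ‖entry (g : LowerTri) (k - 1) (k - 1)‖) hR (fun j hj => ?_)
    (fun j hj => ?_) hz
  -- the bound on products, applied with a diagonal entry of `g`
  · rw [adaptedDual_apply, div_mul_eq_mul_div, le_div_iff₀ hd, mul_comm]
    exact hb j (k - 1) (k - 1) hj le_rfl
  · rw [adaptedDual_apply, entry_eq_zero _ hj]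

/-- Absolute convergence of the triple series over the basis index and the two exponents: with
`k = -c j` the intermediate index, `p = k - a ≥ 0` and `q = -b - 1 - k ≥ 0`, the general term is at
most `C / |w| * (|z| / |w|) ^ k * (R / |z|) ^ p * (R / |w|) ^ q`. -/
theorem summable_triple {c d : ℕ+ → ℤ} (hd : ∀ j, d j = -c j + 1) {z w : ℂ}
    (hz : R < ‖z‖) (hw : R < ‖w‖) (hs : Summable fun j => (‖z‖ / ‖w‖) ^ (-c j)) :
    Summable fun q : ℕ+ × ℤ × ℤ =>
      adapted g (c q.1) q.2.2 * adaptedDual g (d q.1) q.2.1 * (z ^ q.2.1 * w ^ q.2.2) := by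
  have hz0 : 0 < ‖z‖ := hR.trans hz
  have hw0 : 0 < ‖w‖ := hR.trans hw
  have hrz : 0 ≤ R / ‖z‖ := div_nonneg hR.le hz0.le
  have hrw : 0 ≤ R / ‖w‖ := div_nonneg hR.le hw0.le
  have hsz := summable_geomTail hrz ((div_lt_one hz0).2 hz)
  have hsw := summable_geomTail hrw ((div_lt_one hw0).2 hw)
  have hprod : Summable fun q : ℕ+ × ℤ × ℤ =>
      (‖z‖ / ‖w‖) ^ (-c q.1) * (geomTail (R / ‖z‖) q.2.1 * geomTail (R / ‖w‖) q.2.2) :=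
    hs.mul_of_nonneg (hsz.mul_of_nonneg hsw (geomTail_nonneg hrz) (geomTail_nonneg hrw))
      (fun j => zpow_nonneg (div_nonneg hz0.le hw0.le) _)
      (fun q => mul_nonneg (geomTail_nonneg hrz _) (geomTail_nonneg hrw _))
  let e : ℕ+ × ℤ × ℤ → ℕ+ × ℤ × ℤ := fun q => (q.1, -c q.1 - q.2.1, -q.2.2 - 1 - -c q.1)
  have he : Function.Injective e := by
    rintro ⟨j, a, b⟩ ⟨j', a', b'⟩ h
    simp only [e, Prod.mk.injEq] at h
    obtain ⟨rfl, h1, h2⟩ := h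
    simp only [Prod.mk.injEq, true_and]
    omega
  refine Summable.of_norm_bounded ((hprod.comp_injective he).mul_left (C / ‖w‖)) ?_
  rintro ⟨j, a, b⟩
  simp only [Function.comp_apply, e]
  rw [adapted_mul_adaptedDual g (hd j)]
  generalize -c j = k
  obtain ⟨m, rfl⟩ : ∃ m, b = -m - 1 := ⟨-b - 1, by ring⟩
  rw [show -(-m - 1) - 1 = m by ring]
  by_cases h1 : a ≤ k
  · by_cases h2 : k ≤ m
    · rw [geomTail, geomTail, if_pos (by omega), if_pos (by omega), norm_mul, norm_mul, norm_mul,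
        norm_zpow, norm_zpow]
      refine (mul_le_mul_of_nonneg_right (hb a k m h1 h2) (by positivity)).trans (le_of_eq ?_)
      rw [show m - a = (m - k) + (k - a) by ring, zpow_add₀ hR.ne',
        show ‖z‖ ^ a = ‖z‖ ^ k / ‖z‖ ^ (k - a) by
          rw [← zpow_sub₀ hz0.ne']; congr 1; ring,
        show ‖w‖ ^ (-m - 1) = (‖w‖ ^ k)⁻¹ * (‖w‖ ^ (m - k))⁻¹ * ‖w‖⁻¹ by
          rw [← zpow_neg, ← zpow_neg, ← zpow_neg_one, ← zpow_add₀ hw0.ne', ← zpow_add₀ hw0.ne']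
          congr 1; ring,
        div_zpow, div_zpow, div_zpow]
      have := (zpow_pos hz0 (k - a)).ne'
      have := (zpow_pos hw0 (m - k)).ne'
      have := (zpow_pos hw0 k).ne'
      field_simp
    · rw [entry_eq_zero _ (not_le.1 h2), geomTail, geomTail, if_neg (show ¬ 0 ≤ m - k by omega)]
      simp
  · rw [entry_eq_zero _ (not_le.1 h1), geomTail, if_neg (show ¬ 0 ≤ k - a by omega)]
    simp

/-- Summing the absolutely convergent triple series in the two orders. -/
theorem hasSum_evalSeries {c d : ℕ+ → ℤ} (hc : Function.Injective c) (hd : ∀ j, d j = -c j + 1)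
    {K : ℤ → ℤ → ℂ} (hK : ∀ a b, K a b = ∑ᶠ j, adapted g (c j) b * adaptedDual g (d j) a)
    {z w : ℂ} (hz : R < ‖z‖) (hw : R < ‖w‖) (hs : Summable fun j => (‖z‖ / ‖w‖) ^ (-c j)) :
    (Summable fun p : ℤ × ℤ => K p.1 p.2 * (z ^ p.1 * w ^ p.2)) ∧
      HasSum (fun j => evalSeries (adapted g (c j)) w * evalSeries (adaptedDual g (d j)) z)
        (∑' p : ℤ × ℤ, K p.1 p.2 * (z ^ p.1 * w ^ p.2)) := by
  have hT := summable_triple hR hb hd hz hw hs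
  have hcol : ∀ p : ℤ × ℤ, HasSum (fun j =>
      adapted g (c j) p.2 * adaptedDual g (d j) p.1 * (z ^ p.1 * w ^ p.2))
        (K p.1 p.2 * (z ^ p.1 * w ^ p.2)) := fun p => by
    have hfin := finite_support_adapted g hc hd p.1 p.2
    have h := (summable_of_hasFiniteSupport (L := .unconditional _) hfin).hasSum
    rw [tsum_eq_finsum hfin, ← hK] at h
    exact h.mul_right _
  have hrow : ∀ j, HasSum (fun p : ℤ × ℤ =>
      adapted g (c j) p.2 * adaptedDual g (d j) p.1 * (z ^ p.1 * w ^ p.2))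
        (evalSeries (adapted g (c j)) w * evalSeries (adaptedDual g (d j)) z) := fun j => by
    have hre : ∀ p : ℤ × ℤ, adapted g (c j) p.2 * adaptedDual g (d j) p.1 * (z ^ p.1 * w ^ p.2) =
        (adaptedDual g (d j) p.1 * z ^ p.1) * (adapted g (c j) p.2 * w ^ p.2) := fun p => by ring
    have hTj := hT.prod_factor j
    have h := (summable_adaptedDual hR hb (d j) hz).hasSum.mul
      (summable_adapted hR hb (c j) hw).hasSum (hTj.congr hre)
    rw [mul_comm]
    exact h.congr_fun hre
  exact hasSum_of_hasSum_fiberwise hT hcol hrow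

end Bound

theorem summable_zpow_neg_pnat {r : ℝ} (h : 1 < r) : Summable fun j : ℕ+ => r ^ (-(j : ℤ)) := by
  have h0 : 0 ≤ r⁻¹ := (inv_pos.2 (zero_lt_one.trans h)).le
  refine ((summable_geometric_of_lt_one h0 (inv_lt_one_of_one_lt₀ h)).comp_injective
    PNat.coe_injective).congr fun j => ?_
  simp

theorem summable_zpow_pnat_sub_one {r : ℝ} (h0 : 0 ≤ r) (h : r < 1) :
    Summable fun j : ℕ+ => r ^ (-(-(j : ℤ) + 1)) := by
  refine ((summable_geomTail h0 h).comp_injective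
    (neg_injective.comp injective_neg_pnat_cast_add_one)).congr fun j => ?_
  have := j.pos
  simp only [Function.comp_apply]
  rw [geomTail, if_pos (by omega)]

end PairCorr

end

theorem mainTheorem11 (A : PairCorr.LowerTri) (g : PairCorr.LowerTriˣ)
    (hg : PairCorr.IsMatrixExp A (g : PairCorr.LowerTri)) :
    -- identities of formal double Laurent series, for the two expansion regimes
    (∀ a b : ℤ,
      (Function.support fun j : ℕ+ =>
        PairCorr.adapted g (j : ℤ) b * PairCorr.adaptedDual g (-(j : ℤ) + 1) a).Finite ∧
      PairCorr.corrOut A a b =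
        ∑ᶠ j : ℕ+, PairCorr.adapted g (j : ℤ) b * PairCorr.adaptedDual g (-(j : ℤ) + 1) a) ∧
    (∀ a b : ℤ,
      (Function.support fun j : ℕ+ =>
        PairCorr.adapted g (-(j : ℤ) + 1) b * PairCorr.adaptedDual g (j : ℤ) a).Finite ∧
      PairCorr.corrIn A a b =
        -∑ᶠ j : ℕ+, PairCorr.adapted g (-(j : ℤ) + 1) b * PairCorr.adaptedDual g (j : ℤ) a) ∧
    -- identities of functions, in the region of convergence
    (∀ R C : ℝ, 0 < R →
      (∀ i m k : ℤ, i ≤ m → m ≤ k →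
        ‖PairCorr.entry (g : PairCorr.LowerTri) k m‖ *
          ‖PairCorr.entry ((g⁻¹ : PairCorr.LowerTriˣ) : PairCorr.LowerTri) m i‖
            ≤ C * R ^ (k - i)) →
      (∀ (k : ℤ) (z : ℂ), R < ‖z‖ →
        Summable (fun j : ℤ => PairCorr.adapted g k j * z ^ j) ∧
        Summable (fun j : ℤ => PairCorr.adaptedDual g k j * z ^ j)) ∧
      (∀ z w : ℂ, R < ‖w‖ → ‖w‖ < ‖z‖ →
        Summable (fun p : ℤ × ℤ => PairCorr.corrOut A p.1 p.2 * (z ^ p.1 * w ^ p.2)) ∧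
        HasSum (fun j : ℕ+ =>
          PairCorr.evalSeries (PairCorr.adapted g (j : ℤ)) w *
            PairCorr.evalSeries (PairCorr.adaptedDual g (-(j : ℤ) + 1)) z)
          (PairCorr.pairCorr A z w)) ∧
      (∀ z w : ℂ, R < ‖z‖ → ‖z‖ < ‖w‖ →
        Summable (fun p : ℤ × ℤ => PairCorr.corrIn A p.1 p.2 * (z ^ p.1 * w ^ p.2)) ∧
        HasSum (fun j : ℕ+ =>
          -(PairCorr.evalSeries (PairCorr.adapted g (-(j : ℤ) + 1)) w *
            PairCorr.evalSeries (PairCorr.adaptedDual g (j : ℤ)) z))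
          (PairCorr.pairCorr A z w))) := by
  refine ⟨fun a b => ⟨PairCorr.finite_support_adapted g PairCorr.injective_pnat_cast
      (fun _ => rfl) a b, PairCorr.corrOut_eq_finsum hg a b⟩,
    fun a b => ⟨PairCorr.finite_support_adapted g PairCorr.injective_neg_pnat_cast_add_one
      (fun _ => by ring) a b, PairCorr.corrIn_eq_finsum hg a b⟩, ?_⟩
  intro R C hR hb
  refine ⟨fun k z hz => ⟨PairCorr.summable_adapted hR hb k hz,
    PairCorr.summable_adaptedDual hR hb k hz⟩, fun z w hw hzw => ?_, fun z w hz hzw => ?_⟩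
  · have hs := PairCorr.summable_zpow_neg_pnat ((one_lt_div (hR.trans hw)).2 hzw)
    have h := PairCorr.hasSum_evalSeries hR hb PairCorr.injective_pnat_cast (fun _ => rfl)
      (PairCorr.corrOut_eq_finsum hg) (hw.trans hzw) hw hs
    rw [PairCorr.pairCorr, if_pos hzw]
    exact h
  · have hw := hz.trans hzw
    have hs := PairCorr.summable_zpow_pnat_sub_one (div_nonneg (norm_nonneg z) (norm_nonneg w))
      ((div_lt_one (hR.trans hw)).2 hzw)
    have h := PairCorr.hasSum_evalSeries hR hb PairCorr.injective_neg_pnat_cast_add_one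
      (fun _ => by ring) (K := fun a b => -PairCorr.corrIn A a b)
      (fun a b => by rw [PairCorr.corrIn_eq_finsum hg, neg_neg]) hz hw hs
    simp only [neg_mul, tsum_neg] at h
    rw [PairCorr.pairCorr, if_neg hzw.not_gt, if_pos hzw]
    refine ⟨by simpa using h.1.neg, ?_⟩
    simpa using h.2.neg
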